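/- A residuated lattice is an algebra $\mathbf L=(L,\cdot,\backslash,/,\vee,\wedge,e)$ such that $(L,\cdot,e)$ is a monoid, $(L,\vee,\wedge)$ is a lattice with order $\le$, and $xy\le z\iff y\le x\backslash z\iff x\le z/y$. It is $e$-cyclic if $e/x=x\backslash e$ for all $x$. Put $\lambda_u(x)=(u\backslash xu)\wedge e$, $\rho_u(x)=(ux/u)\wedge e$ and $|x|=x\wedge(e/x)\wedge e$. A convex subalgebra is a subalgebra that is convex with respect to $\le$. A convex subalgebra $H$ is normal if $\lambda_u(x),\rho_u(x)\in H$ for all $x\in H$, $u\in L$. It is prime if, for all convex subalgebras $X,Y$ with $X\cap Y\subseteq H$, we have $X\subseteq H$ or $Y\subseteq H$; it is minimal prime if it is minimal under inclusion among the prime convex subalgebras. The polar of a non-empty $X\subseteq L$ is $X^\perp=\{a\in L:\ |a|\vee|x|=e\text{ for all }x\in X\}$; the principal polars are the sets $\{a\}^\perp$, $a\in L$. A variety is a class of residuated lattices closed under homomorphic images, subalgebras and direct products; it is semilinear if it is generated, as a variety, by its totally ordered members. Consider the identities $$\text{(LP)}\quad((x\backslash y)\wedge e)\vee((y\backslash x)\wedge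 e)\approx e,\qquad \text{(RP)}\quad((y/x)\wedge e)\vee((x/y)\wedge e)\approx e,$$ $$\text{(1a)}\quad\lambda_u((x\vee y)\backslash x)\vee\rho_v((x\vee y)\backslash y)\approx e,\qquad \text{(1b)}\quad\lambda_u(x/(x\vee y))\vee\rho_v(y/(x\vee y))\approx e,$$ and the quasi-identity $$\text{(Q)}\quad x\vee y\approx e\ \Rightarrow\ \lambda_u(x)\vee\rho_v(y)\approx e.$$ **Theorem 5.5.** Let $\mathcal V$ be a variety of residuated lattices. The following are equivalent: 1. $\mathcal V$ is semilinear; 2. $\mathcal V$ satisfies (1a); equivalently, $\mathcal V$ satisfies (1b); 3. $\mathcal V$ satisfies (LP) and (Q); equivalently, $\mathcal V$ satisfies (RP) and (Q). If, in addition, all members of $\mathcal V$ are $e$-cyclic and $\mathcal V$ satisfies (LP) or satisfies (RP), then these conditions are also equivalent to each of the following: 4. for every $\mathbf L\in\mathcal V$, all polars in $\mathbf L$ are normal convex subalgebras; equivalently, for every $\mathbf L\in\mathcal V$, all principal polars in $\mathbf L$ are normal convex subalgebras; 5. for every $\mathbf L\in\mathcal V$, all minimal prime convex subalgebras of $\mathbf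 L$ are normal. -/

import Mathlib

universe u

/-- A residuated lattice `(L, ·, \, /, ∨, ∧, e)`: a monoid and a lattice on the same set, with
`x y ≤ z ↔ y ≤ x \ z ↔ x ≤ z / y`. The unit `e` is written `1`. -/
class ResiduatedLattice (L : Type u) extends Lattice L, Monoid L where
  /-- The left residual: `ldiv x z` is `x \ z`. -/
  ldiv : L → L → L
  /-- The right residual: `rdiv z y` is `z / y`. -/
  rdiv : L → L → L
  mul_le_iff_le_ldiv : ∀ x y z : L, x * y ≤ z ↔ y ≤ ldiv x z
  mul_le_iff_le_rdiv : ∀ x y z : L, x * y ≤ z ↔ x ≤ rdiv z y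

namespace ResiduatedLattice

infix:72 " ⟍ " => ResiduatedLattice.ldiv
infix:72 " ⟋ " => ResiduatedLattice.rdiv

/-- The direct product, with all operations computed coordinatewise. -/
instance instPi {ι : Type u} (L : ι → Type u) [∀ i, ResiduatedLattice (L i)] :
    ResiduatedLattice (∀ i, L i) where
  ldiv x z := fun i => x i ⟍ z i
  rdiv z y := fun i => z i ⟋ y i
  mul_le_iff_le_ldiv x y z := forall_congr' fun i => mul_le_iff_le_ldiv (x i) (y i) (z i)
  mul_le_iff_le_rdiv x y z := forall_congr' fun i => mul_le_iff_le_rdiv (x i) (y i) (z i)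

/-- Homomorphisms of residuated lattices: maps preserving all six operations. -/
structure IsHom {L M : Type u} [ResiduatedLattice L] [ResiduatedLattice M] (f : L → M) :
    Prop where
  map_one : f 1 = 1
  map_mul : ∀ x y, f (x * y) = f x * f y
  map_ldiv : ∀ x y, f (x ⟍ y) = f x ⟍ f y
  map_rdiv : ∀ x y, f (x ⟋ y) = f x ⟋ f y
  map_sup : ∀ x y, f (x ⊔ y) = f x ⊔ f y
  map_inf : ∀ x y, f (x ⊓ y) = f x ⊓ f y

/-! ### Varieties -/

/-- A class of residuated lattices. -/
abbrev RLClass := ∀ (L : Type u) [ResiduatedLattice L], Prop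

/-- A variety: a class closed under homomorphic images, (isomorphic copies of) subalgebras and
direct products. -/
structure IsVariety (V : RLClass.{u}) : Prop where
  homImage : ∀ (L M : Type u) [ResiduatedLattice L] [ResiduatedLattice M] (f : L → M),
    IsHom f → Function.Surjective f → V L → V M
  subalgebra : ∀ (L M : Type u) [ResiduatedLattice L] [ResiduatedLattice M] (f : L → M),
    IsHom f → Function.Injective f → V M → V L
  product : ∀ (ι : Type u) (L : ι → Type u) [∀ i, ResiduatedLattice (L i)],
    (∀ i, V (L i)) → V (∀ i, L i)

/-- The variety generated by a class `K`: the smallest variety containing `K`. -/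
def varietyGeneratedBy (K : RLClass.{u}) : RLClass.{u} := fun L _ =>
  ∀ W : RLClass.{u}, IsVariety W → (∀ (M : Type u) [ResiduatedLattice M], K M → W M) → W L

/-- The order of `L` is total. -/
def IsTotallyOrdered (L : Type u) [ResiduatedLattice L] : Prop :=
  ∀ a b : L, a ≤ b ∨ b ≤ a

/-- `V` is semilinear: it is generated by its linearly ordered members. -/
def IsSemilinear (V : RLClass.{u}) : Prop :=
  ∀ (L : Type u) [ResiduatedLattice L],
    V L ↔ varietyGeneratedBy (fun M _ => V M ∧ IsTotallyOrdered M) L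

/-- Every member of `V` has the property `P`; for a property expressed by an identity or a
quasi-identity, `V` satisfies it. -/
def Satisfies (V P : RLClass.{u}) : Prop :=
  ∀ (L : Type u) [ResiduatedLattice L], V L → P L

/-! ### Conjugations, identities and quasi-identities -/

section
variable {L : Type u} [ResiduatedLattice L]

/-- Left conjugation `λ_w(x) = (w \ x w) ∧ e`. -/
def lconj (w x : L) : L := (w ⟍ (x * w)) ⊓ 1

/-- Right conjugation `ρ_w(x) = (w x / w) ∧ e`. -/
def rconj (w x : L) : L := ((w * x) ⟋ w) ⊓ 1

/-- The absolute value `|x| = x ∧ (e / x) ∧ e`. -/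
def absVal (x : L) : L := x ⊓ ((1 : L) ⟋ x) ⊓ 1

end

/-- e-cyclicity: `e / x = x \ e`. -/
def ECyclic (L : Type u) [ResiduatedLattice L] : Prop :=
  ∀ x : L, (1 : L) ⟋ x = x ⟍ (1 : L)

/-- The left prelinearity law. -/
def LeftPrelinear (L : Type u) [ResiduatedLattice L] : Prop :=
  ∀ x y : L, ((x ⟍ y) ⊓ 1) ⊔ ((y ⟍ x) ⊓ 1) = 1

/-- The right prelinearity law. -/
def RightPrelinear (L : Type u) [ResiduatedLattice L] : Prop :=
  ∀ x y : L, ((y ⟋ x) ⊓ 1) ⊔ ((x ⟋ y) ⊓ 1) = 1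

/-- The identity `λ_w((x ∨ y) \ x) ∨ ρ_v((x ∨ y) \ y) = e`. -/
def LeftConjIdentity (L : Type u) [ResiduatedLattice L] : Prop :=
  ∀ x y w v : L, lconj w ((x ⊔ y) ⟍ x) ⊔ rconj v ((x ⊔ y) ⟍ y) = 1

/-- The identity `λ_w(x / (x ∨ y)) ∨ ρ_v(y / (x ∨ y)) = e`. -/
def RightConjIdentity (L : Type u) [ResiduatedLattice L] : Prop :=
  ∀ x y w v : L, lconj w (x ⟋ (x ⊔ y)) ⊔ rconj v (y ⟋ (x ⊔ y)) = 1

/-- The quasi-identity `x ∨ y = e ⇒ λ_w(x) ∨ ρ_v(y) = e`. -/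
def ConjQuasiIdentity (L : Type u) [ResiduatedLattice L] : Prop :=
  ∀ x y w v : L, x ⊔ y = 1 → lconj w x ⊔ rconj v y = 1

/-! ### Convex subalgebras, primes and polars -/

section
variable {L : Type u} [ResiduatedLattice L]

/-- `H` is (the domain of) an order-convex subalgebra of `L`. -/
structure IsConvexSubalgebra (H : Set L) : Prop where
  one_mem : (1 : L) ∈ H
  mul_mem : ∀ x ∈ H, ∀ y ∈ H, x * y ∈ H
  ldiv_mem : ∀ x ∈ H, ∀ y ∈ H, x ⟍ y ∈ H
  rdiv_mem : ∀ x ∈ H, ∀ y ∈ H, x ⟋ y ∈ H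
  sup_mem : ∀ x ∈ H, ∀ y ∈ H, x ⊔ y ∈ H
  inf_mem : ∀ x ∈ H, ∀ y ∈ H, x ⊓ y ∈ H
  convex : ∀ x ∈ H, ∀ y ∈ H, ∀ z, x ≤ z → z ≤ y → z ∈ H

/-- `H` is a normal convex subalgebra: a convex subalgebra closed under all conjugations. -/
structure IsNormal (H : Set L) : Prop where
  isConvexSubalgebra : IsConvexSubalgebra H
  lconj_mem : ∀ x ∈ H, ∀ y : L, lconj y x ∈ H
  rconj_mem : ∀ x ∈ H, ∀ y : L, rconj y x ∈ H

/-- `H` is a prime convex subalgebra: meet-irreducible among the convex subalgebras. -/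
structure IsPrime (H : Set L) : Prop where
  isConvexSubalgebra : IsConvexSubalgebra H
  subset_or_subset : ∀ X Y : Set L, IsConvexSubalgebra X → IsConvexSubalgebra Y →
    X ∩ Y ⊆ H → X ⊆ H ∨ Y ⊆ H

/-- `H` is minimal, with respect to inclusion, among the prime convex subalgebras. -/
def IsMinimalPrime (H : Set L) : Prop := Minimal IsPrime H

/-- The polar `X^⊥` of a set `X`; the principal polar of `a` is `polar {a}`. -/
def polar (X : Set L) : Set L := {a | ∀ x ∈ X, absVal a ⊔ absVal x = 1}

end

/-- All polars in `L` are normal. -/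
def PolarsNormal (L : Type u) [ResiduatedLattice L] : Prop :=
  ∀ X : Set L, X.Nonempty → IsNormal (polar X)

/-- All principal polars in `L` are normal. -/
def PrincipalPolarsNormal (L : Type u) [ResiduatedLattice L] : Prop :=
  ∀ a : L, IsNormal (polar {a})

/-- All minimal prime convex subalgebras of `L` are normal. -/
def MinimalPrimesNormal (L : Type u) [ResiduatedLattice L] : Prop :=
  ∀ H : Set L, IsMinimalPrime H → IsNormal H

end ResiduatedLattice

/-! Everything turns on the relation `x ⊔ y = 1` between elements of the negative cone. For fixed
`y` it is preserved by enlarging `x` within the cone and by products (`mul_sup_eq_one`), and (Q)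
says that it is preserved by conjugation. Zorn's lemma gives maximal join-closed subsets `U` of the
cone avoiding `1`; the complement of such a `U` in the cone consists of the elements joining with
some member of `U` to `1`. That complement is therefore a submonoid and a prime filter, and under
(Q) it is normal. Factoring by it gives a chain, since prelinearity exhibits two elements joining to
`1`, one of which must lie in the filter. Choosing `U` to contain `(b ⟋ a) ⊓ 1` keeps `a ≰ b` in the
quotient, so the algebra is a subdirect product of chains (`exists_hom_to_chain`). Conversely, (1a)
and (1b) hold in chains, hence in the variety that these generate; they yield prelinearity and (Q)
by substitution. In the e-cyclic case the same filters become convex subalgebras `ortho U`, unions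
of principal polars, and these are exactly the proper minimal primes. Since `x ⊔ y = 1` in the cone
means that `x` lies in the polar of `y`, normality of polars or of minimal primes is again (Q). -/

namespace ResiduatedLattice

/-! ### Residuation, conjugates and absolute values -/

section Arithmetic

variable {L : Type u} [ResiduatedLattice L]

theorem le_ldiv_iff {x y z : L} : y ≤ x ⟍ z ↔ x * y ≤ z := (mul_le_iff_le_ldiv x y z).symm

theorem le_rdiv_iff {x y z : L} : x ≤ z ⟋ y ↔ x * y ≤ z := (mul_le_iff_le_rdiv x y z).symm

theorem mul_ldiv_le (x z : L) : x * (x ⟍ z) ≤ z := le_ldiv_iff.1 le_rfl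

theorem rdiv_mul_le (z y : L) : (z ⟋ y) * y ≤ z := le_rdiv_iff.1 le_rfl

instance : MulLeftMono L where
  elim _ _ _ h := le_ldiv_iff.1 (h.trans (le_ldiv_iff.2 le_rfl))

instance : MulRightMono L where
  elim _ _ _ h := le_rdiv_iff.1 (h.trans (le_rdiv_iff.2 le_rfl))

theorem mul_sup_le {x y z w : L} (h₁ : x * y ≤ w) (h₂ : x * z ≤ w) : x * (y ⊔ z) ≤ w :=
  le_ldiv_iff.1 (sup_le (le_ldiv_iff.2 h₁) (le_ldiv_iff.2 h₂))

theorem sup_mul_le {x y z w : L} (h₁ : x * z ≤ w) (h₂ : y * z ≤ w) : (x ⊔ y) * z ≤ w :=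
  le_rdiv_iff.1 (sup_le (le_rdiv_iff.2 h₁) (le_rdiv_iff.2 h₂))

theorem mul_le_of_left_le_one {x y : L} (hx : x ≤ 1) : x * y ≤ y :=
  (mul_le_mul_left hx y).trans_eq (one_mul y)

theorem mul_le_of_right_le_one {x y : L} (hy : y ≤ 1) : x * y ≤ x :=
  (mul_le_mul_right hy x).trans_eq (mul_one x)

theorem lconj_le_one (w x : L) : lconj w x ≤ 1 := inf_le_right

theorem rconj_le_one (w x : L) : rconj w x ≤ 1 := inf_le_right

theorem mul_lconj_le (w x : L) : w * lconj w x ≤ x * w := le_ldiv_iff.1 inf_le_left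

theorem rconj_mul_le (w x : L) : rconj w x * w ≤ w * x := le_rdiv_iff.1 inf_le_left

theorem lconj_mono (w : L) {x y : L} (h : x ≤ y) : lconj w x ≤ lconj w y :=
  le_inf (le_ldiv_iff.2 ((mul_lconj_le w x).trans (mul_le_mul_left h w))) inf_le_right

theorem rconj_mono (w : L) {x y : L} (h : x ≤ y) : rconj w x ≤ rconj w y :=
  le_inf (le_rdiv_iff.2 ((rconj_mul_le w x).trans (mul_le_mul_right h w))) inf_le_right

theorem lconj_eq_one (w : L) {x : L} (h : 1 ≤ x) : lconj w x = 1 :=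
  le_antisymm inf_le_right
    (le_inf (le_ldiv_iff.2 (by simpa using mul_le_mul_left h w)) le_rfl)

theorem rconj_eq_one (w : L) {x : L} (h : 1 ≤ x) : rconj w x = 1 :=
  le_antisymm inf_le_right
    (le_inf (le_rdiv_iff.2 (by simpa using mul_le_mul_right h w)) le_rfl)

theorem one_ldiv (x : L) : (1 : L) ⟍ x = x :=
  le_antisymm (by simpa using mul_ldiv_le 1 x) (le_ldiv_iff.2 (one_mul x).le)

theorem rdiv_one (x : L) : x ⟋ (1 : L) = x :=
  le_antisymm (by simpa using rdiv_mul_le x 1) (le_rdiv_iff.2 (mul_one x).le)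

theorem lconj_one_left (x : L) : lconj 1 x = x ⊓ 1 := by simp [lconj, one_ldiv]

theorem rconj_one_left (x : L) : rconj 1 x = x ⊓ 1 := by simp [rconj, rdiv_one]

theorem one_le_ldiv {x y : L} (h : x ≤ y) : 1 ≤ x ⟍ y := le_ldiv_iff.2 (by simpa using h)

theorem one_le_rdiv {x y : L} (h : x ≤ y) : 1 ≤ y ⟋ x := le_rdiv_iff.2 (by simpa using h)

theorem sup_ldiv_le (x y z : L) : (x ⊔ y) ⟍ z ≤ y ⟍ z :=
  le_ldiv_iff.2 ((mul_le_mul_left le_sup_right _).trans (mul_ldiv_le _ _))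

theorem rdiv_sup_le (x y z : L) : z ⟋ (x ⊔ y) ≤ z ⟋ y :=
  le_rdiv_iff.2 ((mul_le_mul_right le_sup_right _).trans (rdiv_mul_le _ _))

theorem absVal_le_one (x : L) : absVal x ≤ 1 := inf_le_right

theorem absVal_le (x : L) : absVal x ≤ x := inf_le_left.trans inf_le_left

theorem absVal_mul_le_one (x : L) : absVal x * x ≤ 1 :=
  le_rdiv_iff.1 (inf_le_left.trans inf_le_right)

theorem le_absVal {x h : L} (h₁ : h ≤ 1) (h₂ : h ≤ x) (h₃ : h * x ≤ 1) : h ≤ absVal x :=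
  le_inf (le_inf h₂ (le_rdiv_iff.2 h₃)) h₁

theorem absVal_of_le_one {x : L} (h : x ≤ 1) : absVal x = x :=
  le_antisymm (absVal_le x) (le_absVal h le_rfl ((mul_le_of_left_le_one h).trans h))

theorem absVal_eq_one {x : L} (h : absVal x = 1) : x = 1 :=
  le_antisymm (by simpa [h] using absVal_mul_le_one x) (h ▸ absVal_le x)

/-- The elements of the negative cone that join with `c` to `1` are closed under products. -/
theorem mul_sup_eq_one {x y c : L} (hx : x ≤ 1) (hy : y ≤ 1) (hxc : x ⊔ c = 1)
    (hyc : y ⊔ c = 1) : x * y ⊔ c = 1 := by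
  have hc : c ≤ 1 := hxc ▸ le_sup_right
  refine le_antisymm (sup_le ((mul_le_of_left_le_one hx).trans hy) hc) ?_
  -- Of the four products in the expansion, all but `x * y` have a factor `c` and so lie below `c`.
  calc (1 : L) = (x ⊔ c) * (y ⊔ c) := by simp [hxc, hyc]
    _ ≤ x * y ⊔ c := sup_mul_le
        (mul_sup_le le_sup_left ((mul_le_of_left_le_one hx).trans le_sup_right))
        ((mul_le_of_right_le_one hyc.le).trans le_sup_right)

theorem sup_eq_one_of_le {x y c : L} (h : x ≤ y) (hy : y ≤ 1) (hxc : x ⊔ c = 1) :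
    y ⊔ c = 1 :=
  le_antisymm (sup_le hy (hxc ▸ le_sup_right)) (hxc.ge.trans (sup_le_sup_right h c))

end Arithmetic

/-! ### Maximal join-closed subsets of the negative cone -/

section Ideals

variable {L : Type u} [ResiduatedLattice L]

/-- A non-empty set of elements of the negative cone, closed under joins and not containing `1`. -/
structure IsProperJoinClosed (U : Set L) : Prop where
  nonempty : U.Nonempty
  le_one : ∀ x ∈ U, x ≤ 1
  sup_mem : ∀ x ∈ U, ∀ y ∈ U, x ⊔ y ∈ U
  one_notMem : (1 : L) ∉ U

/-- A proper join-closed set to which no element of the negative cone can be added. -/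
structure IsMaximalJoinClosed (U : Set L) : Prop extends IsProperJoinClosed U where
  exists_sup_eq_one : ∀ x ≤ 1, x ∉ U → ∃ y ∈ U, x ⊔ y = 1

theorem IsProperJoinClosed.singleton {t : L} (ht : t ≤ 1) (ht' : t ≠ 1) :
    IsProperJoinClosed {t} where
  nonempty := ⟨t, rfl⟩
  le_one := by rintro x rfl; exact ht
  sup_mem := by rintro x rfl y rfl; simp
  one_notMem h := ht' h.symm

theorem IsProperJoinClosed.exists_maximal {U₀ : Set L} (h₀ : IsProperJoinClosed U₀) :
    ∃ U, U₀ ⊆ U ∧ IsMaximalJoinClosed U := by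
  obtain ⟨U, hU₀, hU⟩ := zorn_subset_nonempty {U : Set L | IsProperJoinClosed U}
    (fun c hc hchain hne => by
      refine ⟨⋃₀ c, ⟨?_, ?_, ?_, ?_⟩, fun s hs => Set.subset_sUnion_of_mem hs⟩
      · obtain ⟨s, hs⟩ := hne
        obtain ⟨x, hx⟩ := (hc hs).nonempty
        exact ⟨x, s, hs, hx⟩
      · rintro x ⟨s, hs, hx⟩
        exact (hc hs).le_one x hx
      · rintro x ⟨s, hs, hx⟩ y ⟨t, ht, hy⟩
        rcases hchain.total hs ht with h | h
        · exact ⟨t, ht, (hc ht).sup_mem x (h hx) y hy⟩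
        · exact ⟨s, hs, (hc hs).sup_mem x hx y (h hy)⟩
      · rintro ⟨s, hs, h⟩
        exact (hc hs).one_notMem h) U₀ h₀
  have hp : IsProperJoinClosed U := hU.prop
  refine ⟨U, hU₀, hp, fun x hx hxU => ?_⟩
  by_contra! hne
  -- The ideal generated by `U` and `x`: it would be proper if `x` joined with no member of `U` to
  -- `1`, and maximality would then put `x` in `U`.
  let W : Set L := {z | ∃ y ∈ U, z ≤ x ⊔ y}
  have hW : IsProperJoinClosed W := by
    refine ⟨?_, ?_, ?_, ?_⟩
    · obtain ⟨y, hy⟩ := hp.nonempty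
      exact ⟨y, y, hy, le_sup_right⟩
    · rintro z ⟨y, hy, hz⟩
      exact hz.trans (sup_le hx (hp.le_one y hy))
    · rintro z ⟨y, hy, hz⟩ z' ⟨y', hy', hz'⟩
      exact ⟨y ⊔ y', hp.sup_mem y hy y' hy',
        sup_le (hz.trans (sup_le_sup_left le_sup_left x))
          (hz'.trans (sup_le_sup_left le_sup_right x))⟩
    · rintro ⟨y, hy, h⟩
      exact hne y hy (le_antisymm (sup_le hx (hp.le_one y hy)) h)
  have hUW : U ⊆ W := fun y hy => ⟨y, hy, le_sup_right⟩
  obtain ⟨y, hy⟩ := hp.nonempty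
  exact hxU (hU.le_of_ge hW hUW ⟨y, hy, le_sup_left⟩)

end Ideals

/-! ### Quotients by normal filters of the negative cone -/

section Quotients

variable {L : Type u} [ResiduatedLattice L]

/-- A submonoid of the negative cone that is closed upwards and under conjugation. -/
structure IsNormalNegFilter (N : Set L) : Prop where
  le_one : ∀ x ∈ N, x ≤ 1
  one_mem : (1 : L) ∈ N
  mul_mem : ∀ x ∈ N, ∀ y ∈ N, x * y ∈ N
  mem_of_le : ∀ x ∈ N, ∀ y, x ≤ y → y ≤ 1 → y ∈ N
  lconj_mem : ∀ x ∈ N, ∀ w, lconj w x ∈ N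
  rconj_mem : ∀ x ∈ N, ∀ w, rconj w x ∈ N

/-- Inequality modulo a set of elements of the negative cone. -/
def LeMod (N : Set L) (x y : L) : Prop := ∃ n ∈ N, n * x ≤ y

namespace IsNormalNegFilter

variable {N : Set L}

theorem leMod_of_le (hN : IsNormalNegFilter N) {x y : L} (h : x ≤ y) : LeMod N x y :=
  ⟨1, hN.one_mem, by simpa using h⟩

theorem leMod_trans (hN : IsNormalNegFilter N) {x y z : L} :
    LeMod N x y → LeMod N y z → LeMod N x z := by
  rintro ⟨n, hn, h⟩ ⟨m, hm, h'⟩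
  exact ⟨m * n, hN.mul_mem m hm n hn,
    (mul_assoc m n x).le.trans ((mul_le_mul_right h m).trans h')⟩

theorem leMod_sup (hN : IsNormalNegFilter N) {x y z : L} :
    LeMod N x z → LeMod N y z → LeMod N (x ⊔ y) z := by
  rintro ⟨n, hn, h⟩ ⟨m, hm, h'⟩
  exact ⟨n * m, hN.mul_mem n hn m hm, mul_sup_le
    ((mul_le_mul_left (mul_le_of_right_le_one (hN.le_one m hm)) x).trans h)
    ((mul_le_mul_left (mul_le_of_left_le_one (hN.le_one n hn)) y).trans h')⟩

theorem leMod_inf (hN : IsNormalNegFilter N) {x y z : L} :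
    LeMod N x y → LeMod N x z → LeMod N x (y ⊓ z) := by
  rintro ⟨n, hn, h⟩ ⟨m, hm, h'⟩
  exact ⟨n * m, hN.mul_mem n hn m hm, le_inf
    ((mul_le_mul_left (mul_le_of_right_le_one (hN.le_one m hm)) x).trans h)
    ((mul_le_mul_left (mul_le_of_left_le_one (hN.le_one n hn)) x).trans h')⟩

theorem leMod_mul (hN : IsNormalNegFilter N) {x y x' y' : L} :
    LeMod N x y → LeMod N x' y' → LeMod N (x * x') (y * y') := by
  rintro ⟨n, hn, h⟩ ⟨m, hm, h'⟩
  -- The multiplier `m` has to cross `x` to reach `x'`; right conjugation pays for this.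
  refine ⟨n * rconj x m, hN.mul_mem n hn _ (hN.rconj_mem m hm x), ?_⟩
  calc n * rconj x m * (x * x') = n * (rconj x m * x) * x' := by simp only [mul_assoc]
    _ ≤ n * (x * m) * x' := mul_le_mul_left (mul_le_mul_right (rconj_mul_le x m) n) x'
    _ = (n * x) * (m * x') := by simp only [mul_assoc]
    _ ≤ y * y' := mul_le_mul' h h'

theorem leMod_ldiv_iff (hN : IsNormalNegFilter N) {x y z : L} :
    LeMod N y (x ⟍ z) ↔ LeMod N (x * y) z := by
  constructor
  · intro h
    exact hN.leMod_trans (hN.leMod_mul (hN.leMod_of_le le_rfl) h)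
      (hN.leMod_of_le (mul_ldiv_le x z))
  · rintro ⟨n, hn, h⟩
    refine ⟨lconj x n, hN.lconj_mem n hn x, le_ldiv_iff.2 ?_⟩
    calc x * (lconj x n * y) = x * lconj x n * y := (mul_assoc _ _ _).symm
      _ ≤ n * x * y := mul_le_mul_left (mul_lconj_le x n) y
      _ = n * (x * y) := mul_assoc _ _ _
      _ ≤ z := h

theorem leMod_rdiv_iff (hN : IsNormalNegFilter N) {x y z : L} :
    LeMod N x (z ⟋ y) ↔ LeMod N (x * y) z := by
  constructor
  · intro h
    exact hN.leMod_trans (hN.leMod_mul h (hN.leMod_of_le le_rfl))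
      (hN.leMod_of_le (rdiv_mul_le z y))
  · rintro ⟨n, hn, h⟩
    exact ⟨n, hn, le_rdiv_iff.2 (by simpa only [mul_assoc] using h)⟩

/-- Equality modulo a normal filter of the negative cone. -/
def setoid (hN : IsNormalNegFilter N) : Setoid L where
  r x y := LeMod N x y ∧ LeMod N y x
  iseqv := ⟨fun _ => ⟨hN.leMod_of_le le_rfl, hN.leMod_of_le le_rfl⟩, fun h => ⟨h.2, h.1⟩,
    fun h h' => ⟨hN.leMod_trans h.1 h'.1, hN.leMod_trans h'.2 h.2⟩⟩

/-- The quotient by a normal filter of the negative cone. -/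
def Quo (hN : IsNormalNegFilter N) : Type u := Quotient hN.setoid

/-- The relation is symmetric, so one of the two inequalities suffices. -/
theorem map₂_compat (hN : IsNormalNegFilter N) {f : L → L → L}
    (hf : ∀ {x x' y y'}, hN.setoid x x' → hN.setoid y y' → LeMod N (f x y) (f x' y'))
    ⦃x x' : L⦄ (hx : hN.setoid x x') ⦃y y' : L⦄ (hy : hN.setoid y y') :
    hN.setoid (f x y) (f x' y') :=
  ⟨hf hx hy, hf (hN.setoid.symm hx) (hN.setoid.symm hy)⟩

instance (hN : IsNormalNegFilter N) : ResiduatedLattice hN.Quo where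
  le := Quotient.lift₂ (LeMod N) fun _ _ _ _ h h' => propext
    ⟨fun k => hN.leMod_trans h.2 (hN.leMod_trans k h'.1),
      fun k => hN.leMod_trans h.1 (hN.leMod_trans k h'.2)⟩
  le_refl := by
    rintro ⟨x⟩
    exact hN.leMod_of_le le_rfl
  le_trans := by
    rintro ⟨x⟩ ⟨y⟩ ⟨z⟩
    exact hN.leMod_trans
  le_antisymm := by
    rintro ⟨x⟩ ⟨y⟩ h h'
    exact Quotient.sound ⟨h, h'⟩
  sup := Quotient.map₂ (· ⊔ ·) <| hN.map₂_compat fun h h' =>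
    hN.leMod_sup (hN.leMod_trans h.1 (hN.leMod_of_le le_sup_left))
      (hN.leMod_trans h'.1 (hN.leMod_of_le le_sup_right))
  le_sup_left := by
    rintro ⟨x⟩ ⟨y⟩
    exact hN.leMod_of_le le_sup_left
  le_sup_right := by
    rintro ⟨x⟩ ⟨y⟩
    exact hN.leMod_of_le le_sup_right
  sup_le := by
    rintro ⟨x⟩ ⟨y⟩ ⟨z⟩
    exact hN.leMod_sup
  inf := Quotient.map₂ (· ⊓ ·) <| hN.map₂_compat fun h h' =>
    hN.leMod_inf (hN.leMod_trans (hN.leMod_of_le inf_le_left) h.1)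
      (hN.leMod_trans (hN.leMod_of_le inf_le_right) h'.1)
  inf_le_left := by
    rintro ⟨x⟩ ⟨y⟩
    exact hN.leMod_of_le inf_le_left
  inf_le_right := by
    rintro ⟨x⟩ ⟨y⟩
    exact hN.leMod_of_le inf_le_right
  le_inf := by
    rintro ⟨x⟩ ⟨y⟩ ⟨z⟩
    exact hN.leMod_inf
  mul := Quotient.map₂ (· * ·) <| hN.map₂_compat fun h h' => hN.leMod_mul h.1 h'.1
  one := Quotient.mk _ 1
  mul_assoc := by
    rintro ⟨x⟩ ⟨y⟩ ⟨z⟩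
    exact congrArg (Quotient.mk _) (mul_assoc x y z)
  one_mul := by
    rintro ⟨x⟩
    exact congrArg (Quotient.mk _) (one_mul x)
  mul_one := by
    rintro ⟨x⟩
    exact congrArg (Quotient.mk _) (mul_one x)
  ldiv := Quotient.map₂ ldiv <| hN.map₂_compat fun h h' =>
    hN.leMod_ldiv_iff.2 (hN.leMod_trans (hN.leMod_mul h.2 (hN.leMod_of_le le_rfl))
      (hN.leMod_trans (hN.leMod_of_le (mul_ldiv_le _ _)) h'.1))
  rdiv := Quotient.map₂ rdiv <| hN.map₂_compat fun h h' =>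
    hN.leMod_rdiv_iff.2 (hN.leMod_trans (hN.leMod_mul (hN.leMod_of_le le_rfl) h'.2)
      (hN.leMod_trans (hN.leMod_of_le (rdiv_mul_le _ _)) h.1))
  mul_le_iff_le_ldiv := by
    rintro ⟨x⟩ ⟨y⟩ ⟨z⟩
    exact hN.leMod_ldiv_iff.symm
  mul_le_iff_le_rdiv := by
    rintro ⟨x⟩ ⟨y⟩ ⟨z⟩
    exact hN.leMod_rdiv_iff.symm

/-- The canonical map to the quotient by a normal filter. -/
def toQuo (hN : IsNormalNegFilter N) (x : L) : hN.Quo := Quotient.mk _ x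

theorem isHom_toQuo (hN : IsNormalNegFilter N) : IsHom hN.toQuo :=
  ⟨rfl, fun _ _ => rfl, fun _ _ => rfl, fun _ _ => rfl, fun _ _ => rfl, fun _ _ => rfl⟩

theorem toQuo_surjective (hN : IsNormalNegFilter N) : Function.Surjective hN.toQuo :=
  Quotient.mk_surjective

theorem toQuo_le_toQuo (hN : IsNormalNegFilter N) {x y : L} :
    hN.toQuo x ≤ hN.toQuo y ↔ LeMod N x y :=
  Iff.rfl

/-- `LeMod` multiplies on the left, so a left residual, which acts on the right of `x`, must first
be conjugated across `x`; the right residual below needs no normality. -/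
theorem leMod_of_ldiv_mem (hN : IsNormalNegFilter N) {x y : L} (h : (x ⟍ y) ⊓ 1 ∈ N) :
    LeMod N x y :=
  ⟨_, hN.rconj_mem _ h x, (rconj_mul_le _ _).trans
    ((mul_le_mul_right inf_le_left x).trans (mul_ldiv_le x y))⟩

theorem leMod_of_rdiv_mem {x y : L} (h : (y ⟋ x) ⊓ 1 ∈ N) : LeMod N x y :=
  ⟨_, h, (mul_le_mul_left inf_le_left x).trans (rdiv_mul_le y x)⟩

theorem rdiv_mem_of_leMod (hN : IsNormalNegFilter N) {x y : L} :
    LeMod N x y → (y ⟋ x) ⊓ 1 ∈ N := by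
  rintro ⟨n, hn, h⟩
  exact hN.mem_of_le n hn _ (le_inf (le_rdiv_iff.2 h) (hN.le_one n hn)) inf_le_right

end IsNormalNegFilter

end Quotients

/-! ### Subdirect representation by chains -/

section Representation

variable {L : Type u} [ResiduatedLattice L]

/-- The elements of the negative cone that join with a member of `U` to `1`. -/
def coneOrtho (U : Set L) : Set L := {x | x ≤ 1 ∧ ∃ y ∈ U, x ⊔ y = 1}

theorem IsMaximalJoinClosed.mem_coneOrtho {U : Set L} (hU : IsMaximalJoinClosed U) {x : L}
    (hx : x ≤ 1) : x ∈ coneOrtho U ↔ x ∉ U := by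
  constructor
  · rintro ⟨-, y, hy, h⟩ hxU
    exact hU.one_notMem (h ▸ hU.sup_mem x hxU y hy)
  · exact fun h => ⟨hx, hU.exists_sup_eq_one x hx h⟩

/-- Otherwise both elements, and hence their join `1`, would lie in `U`. This primeness makes the
quotient a chain. -/
theorem IsMaximalJoinClosed.mem_or_mem {U : Set L} (hU : IsMaximalJoinClosed U) {x y : L}
    (h : x ⊔ y = 1) : x ∈ coneOrtho U ∨ y ∈ coneOrtho U := by
  rw [hU.mem_coneOrtho (h ▸ le_sup_left), hU.mem_coneOrtho (h ▸ le_sup_right)]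
  by_contra! hxy
  exact hU.one_notMem (h ▸ hU.sup_mem x hxy.1 y hxy.2)

/-- Conjugation by `1` fixes the negative cone, so (Q) can be applied to one side at a time. -/
theorem ConjQuasiIdentity.lconj_sup (hQ : ConjQuasiIdentity L) {x y : L} (h : x ⊔ y = 1)
    (w : L) : lconj w x ⊔ y = 1 := by
  have hy : y ≤ 1 := h ▸ le_sup_right
  simpa [rconj_one_left, hy] using hQ x y w 1 h

theorem ConjQuasiIdentity.rconj_sup (hQ : ConjQuasiIdentity L) {x y : L} (h : x ⊔ y = 1)
    (w : L) : rconj w x ⊔ y = 1 := by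
  have hy : y ≤ 1 := h ▸ le_sup_right
  have := hQ y x 1 w (sup_comm x y ▸ h)
  rwa [lconj_one_left, inf_eq_left.2 hy, sup_comm] at this

theorem isNormalNegFilter_coneOrtho (hQ : ConjQuasiIdentity L) {U : Set L}
    (hU : IsProperJoinClosed U) : IsNormalNegFilter (coneOrtho U) where
  le_one _ hx := hx.1
  one_mem := by
    obtain ⟨y, hy⟩ := hU.nonempty
    exact ⟨le_rfl, y, hy, sup_eq_left.2 (hU.le_one y hy)⟩
  mul_mem := by
    rintro x ⟨hx, a, ha, hxa⟩ y ⟨hy, b, hb, hyb⟩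
    have hab : a ⊔ b ≤ 1 := sup_le (hU.le_one a ha) (hU.le_one b hb)
    refine ⟨(mul_le_of_left_le_one hx).trans hy, a ⊔ b, hU.sup_mem a ha b hb,
      mul_sup_eq_one hx hy ?_ ?_⟩
    · exact le_antisymm (sup_le hx hab) (hxa ▸ sup_le_sup_left le_sup_left x)
    · exact le_antisymm (sup_le hy hab) (hyb ▸ sup_le_sup_left le_sup_right y)
  mem_of_le := by
    rintro x ⟨-, a, ha, hxa⟩ y hxy hy
    exact ⟨hy, a, ha, sup_eq_one_of_le hxy hy hxa⟩
  lconj_mem := by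
    rintro x ⟨-, a, ha, hxa⟩ w
    exact ⟨lconj_le_one w x, a, ha, hQ.lconj_sup hxa w⟩
  rconj_mem := by
    rintro x ⟨-, a, ha, hxa⟩ w
    exact ⟨rconj_le_one w x, a, ha, hQ.rconj_sup hxa w⟩

/-- Under prelinearity and the conjugation quasi-identity, homomorphisms onto chains separate
the order. -/
theorem exists_hom_to_chain (hP : LeftPrelinear L ∨ RightPrelinear L)
    (hQ : ConjQuasiIdentity L) {a b : L} (hab : ¬ a ≤ b) :
    ∃ (C : Type u) (_ : ResiduatedLattice C) (f : L → C),
      IsHom f ∧ Function.Surjective f ∧ IsTotallyOrdered C ∧ ¬ f a ≤ f b := by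
  -- This element lies in the filter exactly when the image of `a` is below that of `b`; placing it
  -- in `U` excludes that.
  have ht : (b ⟋ a) ⊓ 1 ≠ 1 := fun h =>
    hab (by simpa using le_rdiv_iff.1 (inf_eq_right.1 h))
  obtain ⟨U, htU, hU⟩ := (IsProperJoinClosed.singleton inf_le_right ht).exists_maximal
  have hN := isNormalNegFilter_coneOrtho hQ hU.toIsProperJoinClosed
  refine ⟨hN.Quo, inferInstance, hN.toQuo, hN.isHom_toQuo, hN.toQuo_surjective, ?_,
    fun h => ?_⟩
  · rintro ⟨x⟩ ⟨y⟩
    rcases hP with hP | hP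
    · exact (hU.mem_or_mem (hP x y)).imp hN.leMod_of_ldiv_mem hN.leMod_of_ldiv_mem
    · exact (hU.mem_or_mem (hP x y)).imp IsNormalNegFilter.leMod_of_rdiv_mem
        IsNormalNegFilter.leMod_of_rdiv_mem
  · exact (hU.mem_coneOrtho inf_le_right).1
      (hN.rdiv_mem_of_leMod (hN.toQuo_le_toQuo.1 h)) (htU rfl)

theorem isSemilinear_of_prelinear {V : RLClass.{u}} (hV : IsVariety V)
    (hP : Satisfies V LeftPrelinear ∨ Satisfies V RightPrelinear)
    (hQ : Satisfies V ConjQuasiIdentity) : IsSemilinear V := by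
  intro L _
  refine ⟨fun hL W hW hK => ?_, fun h => h V hV fun M _ hM => hM.1⟩
  -- One chain for each failure of the order; each is a homomorphic image of `L`, hence in `V`, and
  -- together they embed `L` in their product.
  choose C hC f hf hsurj hchain hsep using fun p : {p : L × L // ¬ p.1 ≤ p.2} =>
    exists_hom_to_chain (hP.imp (· L hL) (· L hL)) (hQ L hL) p.2
  refine hW.subalgebra L (∀ p, C p) (fun x p => f p x) ?_ ?_
    (hW.product _ C fun p => hK _ ⟨hV.homImage _ _ _ (hf p) (hsurj p) hL, hchain p⟩)
  · exact ⟨funext fun p => (hf p).map_one, fun x y => funext fun p => (hf p).map_mul x y,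
      fun x y => funext fun p => (hf p).map_ldiv x y,
      fun x y => funext fun p => (hf p).map_rdiv x y,
      fun x y => funext fun p => (hf p).map_sup x y,
      fun x y => funext fun p => (hf p).map_inf x y⟩
  · have key : ∀ x y : L, (∀ p, f p x = f p y) → x ≤ y := fun x y h => by
      by_contra hxy
      exact hsep ⟨(x, y), hxy⟩ (h _).le
    exact fun x y h => le_antisymm (key x y fun p => congrFun h p)
      (key y x fun p => (congrFun h p).symm)

end Representation

/-! ### Identities in chains and their consequences -/

section Identities

theorem IsHom.map_lconj {L M : Type u} [ResiduatedLattice L] [ResiduatedLattice M] {f : L → M}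
    (hf : IsHom f) (w x : L) : f (lconj w x) = lconj (f w) (f x) := by
  simp only [lconj, hf.map_inf, hf.map_ldiv, hf.map_mul, hf.map_one]

theorem IsHom.map_rconj {L M : Type u} [ResiduatedLattice L] [ResiduatedLattice M] {f : L → M}
    (hf : IsHom f) (w x : L) : f (rconj w x) = rconj (f w) (f x) := by
  simp only [rconj, hf.map_inf, hf.map_rdiv, hf.map_mul, hf.map_one]

theorem isVariety_leftConjIdentity : IsVariety LeftConjIdentity where
  homImage L M _ _ f hf hsurj h x y w v := by
    obtain ⟨x, rfl⟩ := hsurj x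
    obtain ⟨y, rfl⟩ := hsurj y
    obtain ⟨w, rfl⟩ := hsurj w
    obtain ⟨v, rfl⟩ := hsurj v
    simpa only [hf.map_sup, hf.map_lconj, hf.map_rconj, hf.map_ldiv, hf.map_one]
      using congrArg f (h x y w v)
  subalgebra L M _ _ f hf hinj h x y w v := hinj <| by
    simpa only [hf.map_sup, hf.map_lconj, hf.map_rconj, hf.map_ldiv, hf.map_one]
      using h (f x) (f y) (f w) (f v)
  product ι L _ h x y w v := funext fun i => h i (x i) (y i) (w i) (v i)

theorem isVariety_rightConjIdentity : IsVariety RightConjIdentity where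
  homImage L M _ _ f hf hsurj h x y w v := by
    obtain ⟨x, rfl⟩ := hsurj x
    obtain ⟨y, rfl⟩ := hsurj y
    obtain ⟨w, rfl⟩ := hsurj w
    obtain ⟨v, rfl⟩ := hsurj v
    simpa only [hf.map_sup, hf.map_lconj, hf.map_rconj, hf.map_rdiv, hf.map_one]
      using congrArg f (h x y w v)
  subalgebra L M _ _ f hf hinj h x y w v := hinj <| by
    simpa only [hf.map_sup, hf.map_lconj, hf.map_rconj, hf.map_rdiv, hf.map_one]
      using h (f x) (f y) (f w) (f v)
  product ι L _ h x y w v := funext fun i => h i (x i) (y i) (w i) (v i)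

variable {L : Type u} [ResiduatedLattice L]

/-- In a chain `x ⊔ y` is `x` or `y`, so one residual is at least `1` and its conjugate equals `1`.
-/
theorem IsTotallyOrdered.leftConjIdentity (h : IsTotallyOrdered L) : LeftConjIdentity L := by
  intro x y w v
  rcases h x y with hxy | hxy
  · rw [rconj_eq_one v (one_le_ldiv (sup_le hxy le_rfl)), sup_eq_right]
    exact lconj_le_one _ _
  · rw [lconj_eq_one w (one_le_ldiv (sup_le le_rfl hxy)), sup_eq_left]
    exact rconj_le_one _ _

theorem IsTotallyOrdered.rightConjIdentity (h : IsTotallyOrdered L) : RightConjIdentity L := by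
  intro x y w v
  rcases h x y with hxy | hxy
  · rw [rconj_eq_one v (one_le_rdiv (sup_le hxy le_rfl)), sup_eq_right]
    exact lconj_le_one _ _
  · rw [lconj_eq_one w (one_le_rdiv (sup_le le_rfl hxy)), sup_eq_left]
    exact rconj_le_one _ _

theorem IsSemilinear.satisfies {V W : RLClass.{u}} (hV : IsSemilinear V) (hW : IsVariety W)
    (h : ∀ (L : Type u) [ResiduatedLattice L], IsTotallyOrdered L → W L) : Satisfies V W :=
  fun L _ hL => (hV L).1 hL W hW fun M _ hM => h M hM.2

/-- Take both conjugators to be `1` and use that `⟍` is antitone in its denominator. -/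
theorem LeftConjIdentity.leftPrelinear (h : LeftConjIdentity L) : LeftPrelinear L := by
  intro x y
  refine le_antisymm (sup_le inf_le_right inf_le_right) ?_
  have h₁ := h y x 1 1
  rw [lconj_one_left, rconj_one_left, sup_comm y x] at h₁
  refine h₁.ge.trans (sup_le_sup (inf_le_inf_right 1 ?_) (inf_le_inf_right 1 (sup_ldiv_le x y x)))
  rw [sup_comm]
  exact sup_ldiv_le y x y

theorem RightConjIdentity.rightPrelinear (h : RightConjIdentity L) : RightPrelinear L := by
  intro x y
  refine le_antisymm (sup_le inf_le_right inf_le_right) ?_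
  have h₁ := h y x 1 1
  rw [lconj_one_left, rconj_one_left, sup_comm y x] at h₁
  refine h₁.ge.trans (sup_le_sup (inf_le_inf_right 1 ?_) (inf_le_inf_right 1 (rdiv_sup_le x y x)))
  rw [sup_comm]
  exact rdiv_sup_le y x y

theorem LeftConjIdentity.conjQuasiIdentity (h : LeftConjIdentity L) : ConjQuasiIdentity L :=
  fun x y w v hxy => by simpa only [hxy, one_ldiv] using h x y w v

theorem RightConjIdentity.conjQuasiIdentity (h : RightConjIdentity L) : ConjQuasiIdentity L :=
  fun x y w v hxy => by simpa only [hxy, rdiv_one] using h x y w v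

end Identities

theorem tfae_isSemilinear {V : RLClass.{u}} (hV : IsVariety V) :
    List.TFAE [
      IsSemilinear V,
      Satisfies V LeftConjIdentity,
      Satisfies V RightConjIdentity,
      Satisfies V LeftPrelinear ∧ Satisfies V ConjQuasiIdentity,
      Satisfies V RightPrelinear ∧ Satisfies V ConjQuasiIdentity] := by
  tfae_have 1 → 2 := fun h =>
    h.satisfies isVariety_leftConjIdentity fun _ _ hL => hL.leftConjIdentity
  tfae_have 1 → 3 := fun h =>
    h.satisfies isVariety_rightConjIdentity fun _ _ hL => hL.rightConjIdentity
  tfae_have 2 → 4 := fun h =>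
    ⟨fun L _ hL => (h L hL).leftPrelinear, fun L _ hL => (h L hL).conjQuasiIdentity⟩
  tfae_have 3 → 5 := fun h =>
    ⟨fun L _ hL => (h L hL).rightPrelinear, fun L _ hL => (h L hL).conjQuasiIdentity⟩
  tfae_have 4 → 1 := fun h => isSemilinear_of_prelinear hV (.inl h.1) h.2
  tfae_have 5 → 1 := fun h => isSemilinear_of_prelinear hV (.inr h.1) h.2
  tfae_finish

/-! ### Polars as convex subalgebras -/

section Polars

variable {L : Type u} [ResiduatedLattice L]

theorem mem_polar_singleton {a x : L} : a ∈ polar {x} ↔ absVal a ⊔ absVal x = 1 := by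
  simp [polar]

theorem mem_polar_singleton_comm {a x : L} : a ∈ polar {x} ↔ x ∈ polar {a} := by
  rw [mem_polar_singleton, mem_polar_singleton, sup_comm]

/-- Replaces the computation of `absVal a` by any convenient lower bound `h` of it. -/
theorem mem_polar_singleton_of_le {a x h : L} (h₁ : h ≤ 1) (h₂ : h ≤ a) (h₃ : h * a ≤ 1)
    (hx : h ⊔ absVal x = 1) : a ∈ polar {x} :=
  mem_polar_singleton.2 (sup_eq_one_of_le (le_absVal h₁ h₂ h₃) (absVal_le_one a) hx)

theorem absVal_sup_absVal (x y : L) : absVal (absVal x ⊔ absVal y) = absVal x ⊔ absVal y :=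
  absVal_of_le_one (sup_le (absVal_le_one x) (absVal_le_one y))

theorem ECyclic.mul_le_one_comm (hL : ECyclic L) {x y : L} : x * y ≤ 1 ↔ y * x ≤ 1 := by
  rw [← le_rdiv_iff, hL, le_ldiv_iff]

theorem ECyclic.mul_absVal_le_one (hL : ECyclic L) (x : L) : x * absVal x ≤ 1 :=
  hL.mul_le_one_comm.1 (absVal_mul_le_one x)

/-- Products of `absVal x` and `absVal y` still join with `absVal c` to `1`, and suitable ones bound
the absolute value of each compound term from below. Only the two residuals need e-cyclicity,
through `x * absVal x ≤ 1`. -/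
theorem ECyclic.isConvexSubalgebra_polar_singleton (hL : ECyclic L) (c : L) :
    IsConvexSubalgebra (polar {c}) := by
  have one : (1 : L) ∈ polar {c} :=
    mem_polar_singleton_of_le le_rfl le_rfl (mul_one 1).le (sup_eq_left.2 (absVal_le_one c))
  have hle (x y : L) : absVal x * absVal y ≤ 1 :=
    mul_le_one' (absVal_le_one x) (absVal_le_one y)
  have hl (x y : L) : absVal x * absVal y ≤ absVal x := mul_le_of_right_le_one (absVal_le_one y)
  have hr (x y : L) : absVal x * absVal y ≤ absVal y := mul_le_of_left_le_one (absVal_le_one x)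
  have hsup {x y : L} (hx : x ∈ polar {c}) (hy : y ∈ polar {c}) :
      absVal x * absVal y ⊔ absVal c = 1 :=
    mul_sup_eq_one (absVal_le_one x) (absVal_le_one y) (mem_polar_singleton.1 hx)
      (mem_polar_singleton.1 hy)
  refine ⟨one, fun x hx y hy => ?_, fun x hx y hy => ?_, fun x hx y hy => ?_,
    fun x hx y hy => ?_, fun x hx y hy => ?_, fun x hx y hy z hxz hzy => ?_⟩
  · refine mem_polar_singleton_of_le (mul_le_one' (hle y x) (hle x y))
      ((mul_le_of_left_le_one (hle y x)).trans (mul_le_mul' (absVal_le x) (absVal_le y)))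
      ?_ (mul_sup_eq_one (hle y x) (hle x y) (hsup hy hx) (hsup hx hy))
    calc absVal y * absVal x * (absVal x * absVal y) * (x * y)
        ≤ absVal y * absVal x * (x * y) :=
          mul_le_mul_left (mul_le_of_right_le_one (hle x y)) _
      _ = absVal y * (absVal x * x) * y := by simp only [mul_assoc]
      _ ≤ absVal y * 1 * y := by gcongr; exact absVal_mul_le_one x
      _ ≤ 1 := by rw [mul_one]; exact absVal_mul_le_one y
  · refine mem_polar_singleton_of_le (mul_le_one' (hle x y) (hle y x)) ?_ ?_
      (mul_sup_eq_one (hle x y) (hle y x) (hsup hx hy) (hsup hy hx))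
    · refine (mul_le_of_right_le_one (hle y x)).trans (le_ldiv_iff.2 ?_)
      calc x * (absVal x * absVal y) = x * absVal x * absVal y := (mul_assoc _ _ _).symm
        _ ≤ absVal y := mul_le_of_left_le_one (hL.mul_absVal_le_one x)
        _ ≤ y := absVal_le y
    · calc absVal x * absVal y * (absVal y * absVal x) * (x ⟍ y)
          ≤ absVal y * absVal x * (x ⟍ y) :=
            mul_le_mul_left (mul_le_of_left_le_one (hle x y)) _
        _ ≤ absVal y * x * (x ⟍ y) := by gcongr; exact absVal_le x
        _ = absVal y * (x * (x ⟍ y)) := mul_assoc _ _ _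
        _ ≤ absVal y * y := by gcongr; exact mul_ldiv_le x y
        _ ≤ 1 := absVal_mul_le_one y
  · refine mem_polar_singleton_of_le (mul_le_one' (hle y x) (hle x y)) ?_ ?_
      (mul_sup_eq_one (hle y x) (hle x y) (hsup hy hx) (hsup hx hy))
    · refine (mul_le_of_left_le_one (hle y x)).trans (le_rdiv_iff.2 ?_)
      calc absVal x * absVal y * y = absVal x * (absVal y * y) := mul_assoc _ _ _
        _ ≤ absVal x := mul_le_of_right_le_one (absVal_mul_le_one y)
        _ ≤ x := absVal_le x
    · refine hL.mul_le_one_comm.1 ?_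
      calc (x ⟋ y) * (absVal y * absVal x * (absVal x * absVal y))
          ≤ (x ⟋ y) * (absVal y * absVal x) :=
            mul_le_mul_right (mul_le_of_right_le_one (hle x y)) _
        _ ≤ (x ⟋ y) * (y * absVal x) := by gcongr; exact absVal_le y
        _ = (x ⟋ y) * y * absVal x := (mul_assoc _ _ _).symm
        _ ≤ x * absVal x := by gcongr; exact rdiv_mul_le x y
        _ ≤ 1 := hL.mul_absVal_le_one x
  · refine mem_polar_singleton_of_le (hle x y) ((hl x y).trans ((absVal_le x).trans le_sup_left))
      (mul_sup_le ?_ ?_) (hsup hx hy)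
    · exact (mul_le_mul_left (hl x y) x).trans (absVal_mul_le_one x)
    · exact (mul_le_mul_left (hr x y) y).trans (absVal_mul_le_one y)
  · exact mem_polar_singleton_of_le (hle x y)
      (le_inf ((hl x y).trans (absVal_le x)) ((hr x y).trans (absVal_le y)))
      ((mul_le_mul' (hl x y) inf_le_left).trans (absVal_mul_le_one x)) (hsup hx hy)
  · exact mem_polar_singleton_of_le (hle x y) ((hl x y).trans ((absVal_le x).trans hxz))
      ((mul_le_mul' (hr x y) hzy).trans (absVal_mul_le_one y)) (hsup hx hy)

theorem polar_eq_biInter (X : Set L) : polar X = ⋂ x ∈ X, polar {x} := by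
  ext a
  simp [polar]

theorem IsConvexSubalgebra.biInter {ι : Type*} {I : Set ι} {H : ι → Set L}
    (h : ∀ i ∈ I, IsConvexSubalgebra (H i)) : IsConvexSubalgebra (⋂ i ∈ I, H i) := by
  constructor <;> simp only [Set.mem_iInter]
  · exact fun i hi => (h i hi).one_mem
  · exact fun x hx y hy i hi => (h i hi).mul_mem x (hx i hi) y (hy i hi)
  · exact fun x hx y hy i hi => (h i hi).ldiv_mem x (hx i hi) y (hy i hi)
  · exact fun x hx y hy i hi => (h i hi).rdiv_mem x (hx i hi) y (hy i hi)
  · exact fun x hx y hy i hi => (h i hi).sup_mem x (hx i hi) y (hy i hi)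
  · exact fun x hx y hy i hi => (h i hi).inf_mem x (hx i hi) y (hy i hi)
  · exact fun x hx y hy z hxz hzy i hi => (h i hi).convex x (hx i hi) y (hy i hi) z hxz hzy

/-- A union of a non-empty directed family of convex subalgebras is a convex subalgebra. -/
theorem IsConvexSubalgebra.biUnion {ι : Type*} {I : Set ι} {H : ι → Set L} (hI : I.Nonempty)
    (hdir : ∀ i ∈ I, ∀ j ∈ I, ∃ k ∈ I, H i ⊆ H k ∧ H j ⊆ H k)
    (h : ∀ i ∈ I, IsConvexSubalgebra (H i)) : IsConvexSubalgebra (⋃ i ∈ I, H i) := by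
  have key {x y : L} (hx : ∃ i ∈ I, x ∈ H i) (hy : ∃ i ∈ I, y ∈ H i) :
      ∃ i ∈ I, x ∈ H i ∧ y ∈ H i := by
    obtain ⟨i, hi, hx⟩ := hx
    obtain ⟨j, hj, hy⟩ := hy
    obtain ⟨k, hk, hik, hjk⟩ := hdir i hi j hj
    exact ⟨k, hk, hik hx, hjk hy⟩
  constructor <;> simp only [Set.mem_iUnion, exists_prop]
  · obtain ⟨i, hi⟩ := hI
    exact ⟨i, hi, (h i hi).one_mem⟩
  · intro x hx y hy
    obtain ⟨i, hi, hx, hy⟩ := key hx hy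
    exact ⟨i, hi, (h i hi).mul_mem x hx y hy⟩
  · intro x hx y hy
    obtain ⟨i, hi, hx, hy⟩ := key hx hy
    exact ⟨i, hi, (h i hi).ldiv_mem x hx y hy⟩
  · intro x hx y hy
    obtain ⟨i, hi, hx, hy⟩ := key hx hy
    exact ⟨i, hi, (h i hi).rdiv_mem x hx y hy⟩
  · intro x hx y hy
    obtain ⟨i, hi, hx, hy⟩ := key hx hy
    exact ⟨i, hi, (h i hi).sup_mem x hx y hy⟩
  · intro x hx y hy
    obtain ⟨i, hi, hx, hy⟩ := key hx hy
    exact ⟨i, hi, (h i hi).inf_mem x hx y hy⟩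
  · intro x hx y hy z hxz hzy
    obtain ⟨i, hi, hx, hy⟩ := key hx hy
    exact ⟨i, hi, (h i hi).convex x hx y hy z hxz hzy⟩

theorem ECyclic.isConvexSubalgebra_polar (hL : ECyclic L) (X : Set L) :
    IsConvexSubalgebra (polar X) := by
  rw [polar_eq_biInter]
  exact .biInter fun x _ => hL.isConvexSubalgebra_polar_singleton x

theorem IsConvexSubalgebra.absVal_mem {H : Set L} (hH : IsConvexSubalgebra H) {x : L}
    (hx : x ∈ H) : absVal x ∈ H :=
  hH.inf_mem _ (hH.inf_mem _ hx _ (hH.rdiv_mem _ hH.one_mem _ hx)) _ hH.one_mem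

theorem absVal_lconj_sup (hQ : ConjQuasiIdentity L) {x y : L} (h : absVal x ⊔ absVal y = 1)
    (w : L) : absVal (lconj w x) ⊔ absVal y = 1 := by
  rw [absVal_of_le_one (lconj_le_one w x)]
  exact sup_eq_one_of_le (lconj_mono w (absVal_le x)) (lconj_le_one w x) (hQ.lconj_sup h w)

theorem absVal_rconj_sup (hQ : ConjQuasiIdentity L) {x y : L} (h : absVal x ⊔ absVal y = 1)
    (w : L) : absVal (rconj w x) ⊔ absVal y = 1 := by
  rw [absVal_of_le_one (rconj_le_one w x)]
  exact sup_eq_one_of_le (rconj_mono w (absVal_le x)) (rconj_le_one w x) (hQ.rconj_sup h w)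

theorem ECyclic.isNormal_polar (hL : ECyclic L) (hQ : ConjQuasiIdentity L) (X : Set L) :
    IsNormal (polar X) where
  isConvexSubalgebra := hL.isConvexSubalgebra_polar X
  lconj_mem _ hx w y hy := absVal_lconj_sup hQ (hx y hy) w
  rconj_mem _ hx w y hy := absVal_rconj_sup hQ (hx y hy) w

/-- Conjugate `x` inside the polar of `y`, exchange roles by symmetry of orthogonality, then
conjugate `y` inside the polar of the new element. -/
theorem PrincipalPolarsNormal.conjQuasiIdentity (h : PrincipalPolarsNormal L) :
    ConjQuasiIdentity L := by
  intro x y w v hxy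
  have hx : x ≤ 1 := hxy ▸ le_sup_left
  have hy : y ≤ 1 := hxy ▸ le_sup_right
  have h₁ : x ∈ polar {y} := by
    rwa [mem_polar_singleton, absVal_of_le_one hx, absVal_of_le_one hy]
  have h₂ := (h _).rconj_mem y (mem_polar_singleton_comm.1 ((h y).lconj_mem x h₁ w)) v
  rwa [mem_polar_singleton, absVal_of_le_one (rconj_le_one _ _),
    absVal_of_le_one (lconj_le_one _ _), sup_comm] at h₂

/-- If `z` is orthogonal to everything orthogonal to `x` and to everything orthogonal to `y`, then
it is orthogonal to everything orthogonal to `|x| ∨ |y|`. -/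
theorem mem_polar_polar_sup {x y z : L} (hx : z ∈ polar (polar {x})) (hy : z ∈ polar (polar {y})) :
    z ∈ polar (polar {absVal x ⊔ absVal y}) := by
  intro w hw
  rw [mem_polar_singleton, absVal_sup_absVal] at hw
  -- Reassociating the triple join shows that `absVal w ⊔ absVal x` is orthogonal to `y`, hence to
  -- `z`; then `absVal z ⊔ absVal w` is orthogonal to `x`, hence to `z`, which absorbs the repeated
  -- `absVal z`.
  have h₁ := hy (absVal w ⊔ absVal x) (by
    rw [mem_polar_singleton, absVal_sup_absVal, sup_assoc, hw])
  rw [absVal_sup_absVal] at h₁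
  have h₂ := hx (absVal z ⊔ absVal w) (by
    rw [mem_polar_singleton, absVal_sup_absVal, sup_assoc, h₁])
  rwa [absVal_sup_absVal, ← sup_assoc, sup_idem] at h₂

theorem mem_polar_polar_self (x : L) : x ∈ polar (polar {x}) :=
  fun _ hy => mem_polar_singleton.1 (mem_polar_singleton_comm.1 hy)

theorem polar_polar_trans {x y z : L} (hy : y ∈ polar (polar {x})) (hz : z ∈ polar (polar {y})) :
    z ∈ polar (polar {x}) :=
  fun w hw => hz w (mem_polar_singleton_comm.1 (mem_polar_singleton.2 (hy w hw)))

end Polars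

/-! ### Minimal prime convex subalgebras -/

section Primes

variable {L : Type u} [ResiduatedLattice L]

/-- The elements whose absolute value joins with a member of `U` to `1`. -/
def ortho (U : Set L) : Set L := ⋃ u ∈ U, polar {u}

theorem IsMaximalJoinClosed.mem_ortho {U : Set L} (hU : IsMaximalJoinClosed U) {x : L} :
    x ∈ ortho U ↔ absVal x ∉ U := by
  rw [← hU.mem_coneOrtho (absVal_le_one x)]
  simp only [ortho, coneOrtho, Set.mem_iUnion, mem_polar_singleton, exists_prop,
    Set.mem_ofPred_eq, absVal_le_one, true_and]
  exact exists_congr fun u => and_congr_right fun hu => by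
    rw [absVal_of_le_one (hU.le_one u hu)]

theorem ECyclic.isConvexSubalgebra_ortho (hL : ECyclic L) {U : Set L}
    (hU : IsProperJoinClosed U) : IsConvexSubalgebra (ortho U) := by
  refine .biUnion hU.nonempty (fun u hu v hv => ⟨u ⊔ v, hU.sup_mem u hu v hv, ?_⟩)
    fun u _ => hL.isConvexSubalgebra_polar_singleton u
  have hu' := absVal_of_le_one (hU.le_one u hu)
  have hv' := absVal_of_le_one (hU.le_one v hv)
  have huv := absVal_of_le_one (hU.le_one _ (hU.sup_mem u hu v hv))
  constructor <;> intro x hx <;> rw [mem_polar_singleton, sup_comm] at hx ⊢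
  · exact sup_eq_one_of_le (by rw [hu', huv]; exact le_sup_left) (absVal_le_one _) hx
  · exact sup_eq_one_of_le (by rw [hv', huv]; exact le_sup_right) (absVal_le_one _) hx

theorem ECyclic.isPrime_ortho (hL : ECyclic L) {U : Set L} (hU : IsMaximalJoinClosed U) :
    IsPrime (ortho U) where
  isConvexSubalgebra := hL.isConvexSubalgebra_ortho hU.toIsProperJoinClosed
  subset_or_subset X Y hX hY hXY := by
    by_contra! h
    obtain ⟨⟨x, hx, hxU⟩, ⟨y, hy, hyU⟩⟩ := h.imp Set.not_subset.1 Set.not_subset.1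
    rw [hU.mem_ortho, not_not] at hxU hyU
    have hle : absVal x ⊔ absVal y ≤ 1 := sup_le (absVal_le_one x) (absVal_le_one y)
    -- By convexity `absVal x ⊔ absVal y` lies in both `X` and `Y`, yet it belongs to the
    -- join-closed set `U`.
    refine hU.mem_ortho.1 (hXY ⟨?_, ?_⟩)
      ((absVal_sup_absVal x y).symm ▸ hU.sup_mem _ hxU _ hyU)
    · exact hX.convex _ (hX.absVal_mem hx) _ hX.one_mem _ le_sup_left hle
    · exact hY.convex _ (hY.absVal_mem hy) _ hY.one_mem _ le_sup_right hle

/-- The polar and double polar of `x` meet only in `1`, so `P` contains one of them; the double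
polar contains `x`. -/
theorem ECyclic.polar_subset_of_notMem (hL : ECyclic L) {P : Set L} (hP : IsPrime P) {x : L}
    (hx : x ∉ P) : polar {x} ⊆ P := by
  refine (hP.subset_or_subset _ _ (hL.isConvexSubalgebra_polar {x})
    (hL.isConvexSubalgebra_polar (polar {x})) ?_).resolve_right
    fun h => hx (h (mem_polar_polar_self x))
  rintro y ⟨hy, hy'⟩
  have h : absVal y = 1 := by simpa using hy' y hy
  exact absVal_eq_one h ▸ hP.isConvexSubalgebra.one_mem

theorem ECyclic.isMinimalPrime_ortho (hL : ECyclic L) {U : Set L} (hU : IsMaximalJoinClosed U) :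
    IsMinimalPrime (ortho U) := by
  refine ⟨hL.isPrime_ortho hU, fun P hP hPU x hx => ?_⟩
  simp only [ortho, Set.mem_iUnion, exists_prop] at hx
  obtain ⟨u, hu, hxu⟩ := hx
  refine hL.polar_subset_of_notMem hP (fun huP => hU.mem_ortho.1 (hPU huP) ?_) hxu
  rwa [absVal_of_le_one (hU.le_one u hu)]

/-- Below every proper prime convex subalgebra there is one of the form `ortho U`. -/
theorem ECyclic.exists_ortho_subset (hL : ECyclic L) {P : Set L} (hP : IsPrime P)
    (hne : P ≠ Set.univ) : ∃ U, IsMaximalJoinClosed U ∧ ortho U ⊆ P := by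
  -- This set contains `absVal c` for every `c ∉ P`. Double polars stand in for generated convex
  -- subalgebras: primeness of `P` applied to two of them gives closure under joins.
  have hF : IsProperJoinClosed {x : L | x ≤ 1 ∧ ∃ c ∉ P, c ∈ polar (polar {x})} := by
    refine ⟨?_, fun x hx => hx.1, ?_, ?_⟩
    · obtain ⟨c, hc⟩ := (Set.ne_univ_iff_exists_notMem P).1 hne
      refine ⟨absVal c, absVal_le_one c, c, hc, fun w hw => ?_⟩
      rwa [mem_polar_singleton, absVal_of_le_one (absVal_le_one c), sup_comm] at hw
    · rintro x ⟨hx, c, hc, hcx⟩ y ⟨hy, d, hd, hdy⟩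
      refine ⟨sup_le hx hy, ?_⟩
      have hncd : ¬ polar (polar {c}) ∩ polar (polar {d}) ⊆ P := fun h =>
        (hP.subset_or_subset _ _ (hL.isConvexSubalgebra_polar _) (hL.isConvexSubalgebra_polar _)
          h).elim (fun h => hc (h (mem_polar_polar_self c)))
          fun h => hd (h (mem_polar_polar_self d))
      obtain ⟨f, ⟨hfc, hfd⟩, hf⟩ := Set.not_subset.1 hncd
      refine ⟨f, hf, ?_⟩
      simpa only [absVal_of_le_one hx, absVal_of_le_one hy] using
        mem_polar_polar_sup (polar_polar_trans hcx hfc) (polar_polar_trans hdy hfd)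
    · rintro ⟨-, c, hc, h⟩
      have h1 : c ∈ polar {(1 : L)} := by
        rw [mem_polar_singleton, absVal_of_le_one le_rfl, sup_eq_right]
        exact absVal_le_one c
      have : absVal c = 1 := by simpa using h c h1
      exact hc (absVal_eq_one this ▸ hP.isConvexSubalgebra.one_mem)
  obtain ⟨U, hFU, hU⟩ := hF.exists_maximal
  refine ⟨U, hU, fun x hx => ?_⟩
  by_contra hxP
  refine hU.mem_ortho.1 hx (hFU ⟨absVal_le_one x, x, hxP, fun w hw => ?_⟩)
  rwa [mem_polar_singleton, absVal_of_le_one (absVal_le_one x), sup_comm] at hw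

theorem ECyclic.minimalPrimesNormal (hL : ECyclic L) (hQ : ConjQuasiIdentity L) :
    MinimalPrimesNormal L := by
  intro H hH
  -- `IsPrime` admits the whole algebra, which is trivially normal.
  rcases eq_or_ne H Set.univ with rfl | hne
  · exact ⟨hH.prop.isConvexSubalgebra, fun _ _ _ => trivial, fun _ _ _ => trivial⟩
  obtain ⟨U, hU, hUH⟩ := hL.exists_ortho_subset hH.prop hne
  obtain rfl : ortho U = H := hUH.antisymm (hH.le_of_le (hL.isPrime_ortho hU) hUH)
  refine ⟨hH.prop.isConvexSubalgebra, fun x hx w => ?_, fun x hx w => ?_⟩ <;>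
    simp only [ortho, Set.mem_iUnion, exists_prop] at hx ⊢ <;> obtain ⟨u, hu, hxu⟩ := hx
  · exact ⟨u, hu, (hL.isNormal_polar hQ {u}).lconj_mem x hxu w⟩
  · exact ⟨u, hu, (hL.isNormal_polar hQ {u}).rconj_mem x hxu w⟩

theorem MinimalPrimesNormal.conjQuasiIdentity (h : MinimalPrimesNormal L) (hL : ECyclic L) :
    ConjQuasiIdentity L := by
  intro x y w v hxy
  by_contra hne
  -- If (Q) fails, the offending join goes into `U`. One of `x`, `y` lies in `ortho U`; normality
  -- and convexity then put that join in `ortho U` too, a contradiction.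
  obtain ⟨U, htU, hU⟩ := (IsProperJoinClosed.singleton
    (sup_le (lconj_le_one w x) (rconj_le_one v y)) hne).exists_maximal
  have hN := h _ (hL.isMinimalPrime_ortho hU)
  have ht := htU rfl
  have hx : x ≤ 1 := hxy ▸ le_sup_left
  have hy : y ≤ 1 := hxy ▸ le_sup_right
  have hle := hU.le_one _ ht
  refine hU.mem_ortho.1 ?_ ((absVal_of_le_one hle).symm ▸ ht)
  rcases hU.mem_or_mem hxy with hm | hm
  · have hxN : x ∈ ortho U := by
      rwa [hU.mem_ortho, absVal_of_le_one hx, ← hU.mem_coneOrtho hx]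
    exact hN.isConvexSubalgebra.convex _ (hN.lconj_mem x hxN w) _
      hN.isConvexSubalgebra.one_mem _ le_sup_left hle
  · have hyN : y ∈ ortho U := by
      rwa [hU.mem_ortho, absVal_of_le_one hy, ← hU.mem_coneOrtho hy]
    exact hN.isConvexSubalgebra.convex _ (hN.rconj_mem y hyN v) _
      hN.isConvexSubalgebra.one_mem _ le_sup_right hle

end Primes

end ResiduatedLattice

/-! ### The equivalences -/

open ResiduatedLattice in
theorem theorem5p5 (V : RLClass.{u}) (hV : IsVariety V) :
    List.TFAE [
      IsSemilinear V,
      Satisfies V LeftConjIdentity,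
      Satisfies V RightConjIdentity,
      Satisfies V LeftPrelinear ∧ Satisfies V ConjQuasiIdentity,
      Satisfies V RightPrelinear ∧ Satisfies V ConjQuasiIdentity] ∧
    (Satisfies V ECyclic → (Satisfies V LeftPrelinear ∨ Satisfies V RightPrelinear) →
      List.TFAE [
        IsSemilinear V,
        Satisfies V LeftConjIdentity,
        Satisfies V RightConjIdentity,
        Satisfies V LeftPrelinear ∧ Satisfies V ConjQuasiIdentity,
        Satisfies V RightPrelinear ∧ Satisfies V ConjQuasiIdentity,
        Satisfies V PolarsNormal,
        Satisfies V PrincipalPolarsNormal,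
        Satisfies V MinimalPrimesNormal]) := by
  refine ⟨tfae_isSemilinear hV, fun hE hP => ?_⟩
  have key := tfae_isSemilinear hV
  -- With one prelinearity law assumed, each normality condition only has to yield (Q).
  have hQ (h : Satisfies V ConjQuasiIdentity) : IsSemilinear V :=
    isSemilinear_of_prelinear hV hP h
  have hQ' (h : IsSemilinear V) : Satisfies V ConjQuasiIdentity := (((key.out 0 3 :
    IsSemilinear V ↔ Satisfies V LeftPrelinear ∧ Satisfies V ConjQuasiIdentity)).1 h).2
  tfae_have 1 ↔ 2 := key.out 0 1
  tfae_have 1 ↔ 3 := key.out 0 2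
  tfae_have 1 ↔ 4 := key.out 0 3
  tfae_have 1 ↔ 5 := key.out 0 4
  tfae_have 1 → 6 := fun h L _ hL X _ => (hE L hL).isNormal_polar (hQ' h L hL) X
  tfae_have 6 → 7 := fun h L _ hL a => h L hL {a} (Set.singleton_nonempty a)
  tfae_have 7 → 1 := fun h => hQ fun L _ hL => (h L hL).conjQuasiIdentity
  tfae_have 1 → 8 := fun h L _ hL => (hE L hL).minimalPrimesNormal (hQ' h L hL)
  tfae_have 8 → 1 := fun h => hQ fun L _ hL => (h L hL).conjQuasiIdentity (hE L hL)
  tfae_finish
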